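/- Let $K$ be a field. A weighted graph $(E,w)$ consists of a directed graph $E=(E^0,E^1,s,r)$ and a map $w:E^1\to\{1,2,\dots\}$; the elements of $E^1$ are called structured edges, and $(E,w)$ is finite if $E^0$ and $E^1$ are finite. Put $w(v)=\max\{w(e)\mid e\in s^{-1}(v)\}$ for every vertex $v$ with $s^{-1}(v)\neq\emptyset$. For finite $(E,w)$, the weighted Leavitt path algebra $L_K(E,w)$ is the (not necessarily unital) associative $K$-algebra generated by the vertices $v\in E^0$ and the symbols $e_i,e_i^*$ ($e\in E^1$, $1\le i\le w(e)$) subject to the relations (a) $uv=\delta_{uv}u$ for $u,v\in E^0$; (b) $s(e)e_i=e_i=e_ir(e)$ and $r(e)e_i^*=e_i^*=e_i^*s(e)$ for $e\in E^1$, $1\le i\le w(e)$; (c) $\sum_{e\in s^{-1}(v)}e_ie_j^*=\delta_{ij}v$ for every $v$ with $s^{-1}(v)\ne\emptyset$ and $1\le i,j\le w(v)$; (d) $\sum_{i=1}^{w(v)}e_i^*f_i=\delta_{ef}r(e)$ for every $v$ with $s^{-1}(v)\ne\emptyset$ and $e,f\in s^{-1}(v)$; where $e_i=e_i^*=0$ for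 $i>w(e)$. For $m,n\ge 1$, the Leavitt algebra $L_K(m,n)$ is the unital associative $K$-algebra generated by the entries of an $m\times n$ matrix $X$ and an $n\times m$ matrix $Y$ subject to $XY=I_m$ and $YX=I_n$. Let $A$ be a $K$-algebra that is generated, as a not necessarily unital algebra, by a finite-dimensional subspace $V$, and let $d_V(n)$ be the dimension of the span of all products $v_1\cdots v_k$ with $1\le k\le n$ and $v_1,\dots,v_k\in V$. Then $A$ has exponential growth if there is a real number $a>1$ with $d_V\sim a^n$, where $f\sim g$ means that there are integers $c,c'\ge1$ such that $f(n)\le c\,g(cn)$ and $g(n)\le c'f(c'n)$ for all $n\ge1$; and $\operatorname{GKdim}A=\limsup_{n\to\infty}\log_n d_V(n)$. Neither notion depends on the choice of $V$. (1) Let $(E,w)$ be a finite weighted graph. If there are a vertex $v$ and two distinct structured edges $e,f\in s^{-1}(v)$ with $w(e)\ge2$ and $w(f)\ge2$, then $L_K(E,w)$ has exponential growth, and hence $\operatorname{GKdim}L_K(E,w)=\infty$. (2) In particular, for all integers $n>1$ and $k\ge0$, the Leavitt algebra $L_K(n,n+k)$ has exponential growth, and hence $\operatorname{GKdim}L_K(n,n+k)=\infty$.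 -/

import Mathlib

open Filter

noncomputable section

/-! ### Growth of (not necessarily unital) algebras -/

namespace AlgGrowth

/-- `IsProd V k x` says that `x = v₁ ⋯ v_k` for some `v₁, …, v_k ∈ V` (so `k ≥ 1`). -/
inductive IsProd {A : Type*} [Mul A] (V : Set A) : ℕ → A → Prop
  | single {v : A} : v ∈ V → IsProd V 1 v
  | mul {k : ℕ} {x v : A} : IsProd V k x → v ∈ V → IsProd V (k + 1) (x * v)

variable (K : Type*) [Field K]

section
variable {A : Type*} [NonUnitalRing A] [Module K A]

/-- `V ^ n`: the span of all products `v₁ ⋯ v_k` with `1 ≤ k ≤ n` and all `v_i ∈ V`. -/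
def pow (V : Submodule K A) (n : ℕ) : Submodule K A :=
  Submodule.span K {x | ∃ k ≤ n, IsProd (V : Set A) k x}

/-- `d_V(n) = dim V ^ n`. -/
def growth (V : Submodule K A) (n : ℕ) : ℕ := Module.finrank K (pow K V n)

end

/-- `V` is a finite-dimensional subspace that generates the (possibly non-unital) algebra `A`. -/
def IsGenerating {A : Type*} [NonUnitalRing A] [Module K A] [IsScalarTower K A A]
    [SMulCommClass K A A] (V : Submodule K A) : Prop :=
  FiniteDimensional K V ∧ NonUnitalAlgebra.adjoin K (V : Set A) = ⊤

/-- `f ≼ g` for functions on the positive integers: there is a positive integer `c` with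
`f n ≤ c * g (c * n)` for all `n ≥ 1`. -/
def Preccurly (f g : ℕ → ℝ) : Prop :=
  ∃ c : ℕ, 0 < c ∧ ∀ n : ℕ, 0 < n → f n ≤ c * g (c * n)

/-- Asymptotic equivalence `f ∼ g`. -/
def AsympEquiv (f g : ℕ → ℝ) : Prop := Preccurly f g ∧ Preccurly g f

variable (A : Type*) [NonUnitalRing A] [Module K A] [IsScalarTower K A A] [SMulCommClass K A A]

/-- `A` is finitely generated and has exponential growth: `d_V ∼ a ^ n` for some real `a > 1`.
The condition does not depend on the generating subspace `V`; it is required for all of them. -/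
def HasExponentialGrowth : Prop :=
  (∃ V : Submodule K A, IsGenerating K V) ∧
  ∀ V : Submodule K A, IsGenerating K V →
    ∃ a : ℝ, 1 < a ∧ AsympEquiv (fun n => (growth K V n : ℝ)) (fun n => a ^ n)

/-- `A` is finitely generated and its Gelfand-Kirillov dimension `limsup log_n d_V(n)` is `d`.
The condition does not depend on the generating subspace `V`; it is required for all of them. -/
def HasGKDim (d : EReal) : Prop :=
  (∃ V : Submodule K A, IsGenerating K V) ∧
  ∀ V : Submodule K A, IsGenerating K V →
    limsup (fun n : ℕ => ((Real.logb n (growth K V n) : ℝ) : EReal)) atTop = d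

end AlgGrowth

/-! ### Non-unital algebras given by generators and relations -/

namespace NonUnitalPresentation

variable (K : Type*) [Field K] (X : Type*)

/-- The free non-unital associative `K`-algebra on `X`; the nonempty words over `X` form a
basis. -/
abbrev Free : Type _ := MonoidAlgebra K (FreeSemigroup X)

variable {X}

/-- The generator of the free algebra attached to a letter. -/
def gen (x : X) : Free K X := MonoidAlgebra.single (FreeSemigroup.of x) 1

variable {K} (r : Free K X → Free K X → Prop)

/-- All scalar multiples of the relations `r`. -/
def ScaledRel (a b : Free K X) : Prop :=
  ∃ (c : K) (x y : Free K X), r x y ∧ a = c • x ∧ b = c • y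

/-- The least `K`-algebra congruence containing `r`. -/
def con : RingCon (Free K X) := ringConGen (ScaledRel r)

theorem con_smul (c : K) {a b : Free K X} (h : con r a b) : con r (c • a) (c • b) := by
  change RingConGen.Rel _ _ _ at h
  change RingConGen.Rel _ _ _
  induction h generalizing c with
  | of a b h =>
    obtain ⟨d, x, y, hr, rfl, rfl⟩ := h
    exact .of _ _ ⟨c * d, x, y, hr, by rw [mul_smul], by rw [mul_smul]⟩
  | refl x => exact .refl _
  | symm _ ih => exact (ih c).symm
  | trans _ _ ih₁ ih₂ => exact (ih₁ c).trans (ih₂ c)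
  | add _ _ ih₁ ih₂ => rw [smul_add, smul_add]; exact (ih₁ c).add (ih₂ c)
  | mul _ h₂ ih₁ _ => rw [← smul_mul_assoc, ← smul_mul_assoc]; exact (ih₁ c).mul h₂

/-- The non-unital `K`-algebra with generators `X` and defining relations `a = b` for `r a b`. -/
def Alg : Type _ := (con r).Quotient

instance : NonUnitalRing (Alg r) := inferInstanceAs (NonUnitalRing (con r).Quotient)

/-- The quotient map, as an additive homomorphism. -/
def mkAdd : Free K X →+ Alg r where
  toFun a := ((a : (con r).Quotient))
  map_zero' := rfl
  map_add' _ _ := rfl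

theorem mkAdd_surjective : Function.Surjective (mkAdd r) := Quotient.mk''_surjective

instance : SMul K (Alg r) := ⟨(con r).smulAux fun c _ _ h => con_smul r c h⟩

instance : Module K (Alg r) :=
  Function.Surjective.module K (mkAdd r) (mkAdd_surjective r) fun _ _ => rfl

instance : IsScalarTower K (Alg r) (Alg r) where
  smul_assoc c := Quotient.ind₂' fun x y =>
    congr_arg (mkAdd r) (smul_mul_assoc c x y)

instance : SMulCommClass K (Alg r) (Alg r) where
  smul_comm c := Quotient.ind₂' fun x y =>
    congr_arg (mkAdd r) (mul_smul_comm c x y).symm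

/-- The quotient map, as a homomorphism of non-unital algebras. -/
def mk : Free K X →ₙₐ[K] Alg r where
  toFun := mkAdd r
  map_smul' _ _ := rfl
  map_zero' := rfl
  map_add' _ _ := rfl
  map_mul' _ _ := rfl

end NonUnitalPresentation

/-! ### Weighted graphs and weighted Leavitt path algebras -/

/-- A row-finite weighted graph with vertex set `V`, set of (structured) edges `E`, source map
`s`, range map `r` and weight map `w` with values in the positive integers. -/
structure WeightedGraph (V E : Type*) where
  s : E → V
  r : E → V
  w : E → ℕ
  w_pos : ∀ e, 0 < w e
  rowFinite : ∀ v, (s ⁻¹' {v}).Finite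

namespace WeightedGraph

open NonUnitalPresentation

variable {V E : Type*} (G : WeightedGraph V E)

/-- The finite set `s⁻¹(v)` of edges emitted by `v`. -/
def out (v : V) : Finset E := (G.rowFinite v).toFinset

/-- `w(v)`, the maximum of the weights of the edges emitted by `v` (it is `0` for a sink). -/
def vertexWeight (v : V) : ℕ := (G.out v).sup G.w

/-- Vertices and edges of the double graph of the directed graph associated to `G`. Indices are
shifted by one: for `i : Fin (w e)`, `real e i` is the edge `e_{i+1}` and `ghost e i` is
`e_{i+1}^*`. -/
inductive Letter : Type _
  | vertex (v : V) : Letter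
  | real (e : E) (i : Fin (G.w e)) : Letter
  | ghost (e : E) (i : Fin (G.w e)) : Letter

namespace Letter

variable {G}

/-- Source in the double graph; `s(v) = v` for a vertex. -/
def source : G.Letter → V
  | vertex v => v
  | real e _ => G.s e
  | ghost e _ => G.r e

/-- Range in the double graph; `r(v) = v` for a vertex. -/
def range : G.Letter → V
  | vertex v => v
  | real e _ => G.r e
  | ghost e _ => G.s e

end Letter

variable (K : Type*) [Field K]

/-- A vertex in the free algebra. -/
def vtx (v : V) : Free K G.Letter := gen K (Letter.vertex v)

/-- The element `e_{i+1}` of the free algebra, with `e_{i+1} = 0` if `i + 1 > w(e)`. -/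
def re (e : E) (i : ℕ) : Free K G.Letter :=
  if h : i < G.w e then gen K (Letter.real e ⟨i, h⟩) else 0

/-- The element `e_{i+1}^*` of the free algebra, with `e_{i+1}^* = 0` if `i + 1 > w(e)`. -/
def gh (e : E) (i : ℕ) : Free K G.Letter :=
  if h : i < G.w e then gen K (Letter.ghost e ⟨i, h⟩) else 0

open Classical in
/-- Defining relations of the weighted Leavitt path algebra. The first three are the relations
of the path algebra of the double graph (for a vertex `x`, `source_mul` and `mul_range` are
instances of `vertex_mul`). For the last two, `v` is a regular vertex. -/
inductive Rel : Free K G.Letter → Free K G.Letter → Prop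
  | vertex_mul (u v : V) :
      Rel (G.vtx K u * G.vtx K v) (if u = v then G.vtx K u else 0)
  | source_mul (x : G.Letter) : Rel (G.vtx K x.source * gen K x) (gen K x)
  | mul_range (x : G.Letter) : Rel (gen K x * G.vtx K x.range) (gen K x)
  | real_ghost (v : V) (hv : (G.out v).Nonempty) (i j : ℕ)
      (hi : i < G.vertexWeight v) (hj : j < G.vertexWeight v) :
      Rel (∑ e ∈ G.out v, G.re K e i * G.gh K e j) (if i = j then G.vtx K v else 0)
  | ghost_real (v : V) (e f : E) (he : e ∈ G.out v) (hf : f ∈ G.out v) :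
      Rel (∑ i ∈ Finset.range (G.vertexWeight v), G.gh K e i * G.re K f i)
        (if e = f then G.vtx K (G.r e) else 0)

/-- The weighted Leavitt path algebra `L_K(E, w)`. -/
abbrev LeavittPathAlgebra : Type _ := Alg (G.Rel K)

end WeightedGraph

/-! ### Leavitt algebras -/

namespace LeavittAlgebra

variable (K : Type*) [Field K] (m n : ℕ)

/-- Generators: the entries of an `m × n` matrix and of an `n × m` matrix. -/
abbrev Letter : Type := (Fin m × Fin n) ⊕ (Fin n × Fin m)

/-- The generic `m × n` matrix. -/
def X : Matrix (Fin m) (Fin n) (FreeAlgebra K (Letter m n)) :=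
  Matrix.of fun i j => FreeAlgebra.ι K (Sum.inl (i, j))

/-- The generic `n × m` matrix. -/
def Y : Matrix (Fin n) (Fin m) (FreeAlgebra K (Letter m n)) :=
  Matrix.of fun j i => FreeAlgebra.ι K (Sum.inr (j, i))

/-- The relations `X Y = 1` and `Y X = 1`, entry by entry. -/
inductive Rel : FreeAlgebra K (Letter m n) → FreeAlgebra K (Letter m n) → Prop
  | mul_left (i j : Fin m) :
      Rel ((X K m n * Y K m n) i j) ((1 : Matrix (Fin m) (Fin m) _) i j)
  | mul_right (i j : Fin n) :
      Rel ((Y K m n * X K m n) i j) ((1 : Matrix (Fin n) (Fin n) _) i j)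

end LeavittAlgebra

/-- The Leavitt algebra `L_K(m, n)`: the universal unital `K`-algebra with an `m × n` matrix `X`
and an `n × m` matrix `Y` such that `X Y = 1` and `Y X = 1`. -/
abbrev LeavittAlgebra (K : Type*) [Field K] (m n : ℕ) : Type _ :=
  RingQuot (LeavittAlgebra.Rel K m n)

end

/-!
If `M` is an infinite-dimensional space, then `M ≃ M ^ k` for every `k ≥ 1`, so over `End M` a row
of any positive length has an inverse column. Splicing such a row with such a column gives mutually
inverse matrices `X` and `Y` of any nonzero size that vanish outside of one row and one column.
These zeros make room for all weights, so placing such matrices at every vertex represents the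
weighted Leavitt path algebra. At a vertex with two edges of weight at least two, two elementary row
operations on `X`, and their inverses on the columns of `Y`, turn two products of a ghost edge with
a real edge into arbitrary operators `s` and `t`. If `s` and `t` freely generate, then the two
products generate a free semigroup algebra on two letters, which forces exponential growth, and
hence `d_V(n)` outgrows every power of `n`.
-/

namespace AlgGrowth

variable {K : Type*} [Field K]

section Powers

variable {A : Type*} [NonUnitalRing A] [Module K A]

theorem IsProd.one_le {V : Set A} {k : ℕ} {x : A} (h : IsProd V k x) : 1 ≤ k := by
  cases h <;> omega

theorem IsProd.mul_isProd {V : Set A} {k l : ℕ} {x y : A} (hx : IsProd V k x)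
    (hy : IsProd V l y) : IsProd V (k + l) (x * y) := by
  induction hy with
  | single hv => exact hx.mul hv
  | mul _ hv ih => rw [← mul_assoc, ← add_assoc]; exact ih.mul hv

theorem pow_mono (V : Submodule K A) : Monotone (pow K V) := fun _ _ h =>
  Submodule.span_mono fun _ ⟨k, hk, hx⟩ => ⟨k, hk.trans h, hx⟩

@[simp]
theorem pow_zero (V : Submodule K A) : pow K V 0 = ⊥ := by
  refine Submodule.span_eq_bot.2 ?_
  rintro x ⟨k, hk, hx⟩
  have := hx.one_le
  omega

theorem le_pow_one (V : Submodule K A) : V ≤ pow K V 1 := fun _ hx =>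
  Submodule.subset_span ⟨1, le_rfl, .single hx⟩

variable [IsScalarTower K A A] [SMulCommClass K A A]

theorem mul_mem_pow {V : Submodule K A} {m n : ℕ} {x y : A} (hx : x ∈ pow K V m)
    (hy : y ∈ pow K V n) : x * y ∈ pow K V (m + n) := by
  have h : Submodule.map₂ (LinearMap.mul K A) (pow K V m) (pow K V n) ≤ pow K V (m + n) := by
    rw [pow, pow, Submodule.map₂_span_span, Submodule.span_le]
    rintro _ ⟨x, ⟨k, hk, hx⟩, y, ⟨l, hl, hy⟩, rfl⟩
    exact Submodule.subset_span ⟨k + l, add_le_add hk hl, hx.mul_isProd hy⟩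
  exact h (Submodule.apply_mem_map₂ _ hx hy)

theorem pow_succ_le (V : Submodule K A) (n : ℕ) :
    pow K V (n + 1) ≤ V ⊔ Submodule.map₂ (LinearMap.mul K A) (pow K V n) V := by
  refine Submodule.span_le.2 ?_
  rintro x ⟨k, hk, hx⟩
  cases hx with
  | single hv => exact Submodule.mem_sup_left hv
  | mul hx hv =>
    exact Submodule.mem_sup_right (Submodule.apply_mem_map₂ (LinearMap.mul K A)
      (Submodule.subset_span ⟨_, Nat.le_of_succ_le_succ hk, hx⟩) hv)

theorem IsGenerating.exists_mem_pow {V : Submodule K A} (hV : IsGenerating K V) (x : A) :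
    ∃ n, x ∈ pow K V n := by
  have hx : x ∈ NonUnitalAlgebra.adjoin K (V : Set A) := hV.2 ▸ trivial
  induction hx using NonUnitalAlgebra.adjoin_induction with
  | mem x hx => exact ⟨1, le_pow_one V hx⟩
  | zero => exact ⟨0, zero_mem _⟩
  | smul c x _ hx => exact hx.imp fun _ hm => Submodule.smul_mem _ c hm
  | add x y _ _ hx hy =>
    obtain ⟨m, hm⟩ := hx
    obtain ⟨n, hn⟩ := hy
    exact ⟨m + n, add_mem (pow_mono V (by omega) hm) (pow_mono V (by omega) hn)⟩
  | mul x y _ _ hx hy =>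
    obtain ⟨m, hm⟩ := hx
    obtain ⟨n, hn⟩ := hy
    exact ⟨m + n, mul_mem_pow hm hn⟩

theorem IsGenerating.exists_pos_forall_mem_pow {V : Submodule K A} (hV : IsGenerating K V)
    {α : Type*} [Finite α] (u : α → A) : ∃ m, 0 < m ∧ ∀ i, u i ∈ pow K V m := by
  cases nonempty_fintype α
  choose m hm using fun i => hV.exists_mem_pow (u i)
  refine ⟨Finset.univ.sup m + 1, Nat.succ_pos _, fun i => pow_mono V ?_ (hm i)⟩
  exact (Finset.le_sup (Finset.mem_univ i)).trans (Nat.le_succ _)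

theorem isGenerating_span_of_adjoin_eq_top {S : Set A} (hS : S.Finite)
    (h : NonUnitalAlgebra.adjoin K S = ⊤) : IsGenerating K (Submodule.span K S) :=
  ⟨FiniteDimensional.span_of_finite K hS,
    top_le_iff.1 (h ▸ NonUnitalAlgebra.adjoin_mono Submodule.subset_span)⟩

theorem lift_mem_pow {V : Submodule K A} {m : ℕ} {α : Type*} {u : α → A}
    (hu : ∀ i, u i ∈ pow K V m) (x : FreeSemigroup α) :
    FreeSemigroup.lift u x ∈ pow K V (m * x.length) := by
  induction x using FreeSemigroup.recOnMul with
  | ih1 i => simpa using hu i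
  | ih2 i y hi hy =>
    rw [map_mul, FreeSemigroup.length_mul, mul_add]
    exact mul_mem_pow hi hy

end Powers

section Dimension

theorem finiteDimensional_map₂ {M N P : Type*} [AddCommGroup M] [Module K M] [AddCommGroup N]
    [Module K N] [AddCommGroup P] [Module K P] (f : M →ₗ[K] N →ₗ[K] P) (p : Submodule K M)
    (q : Submodule K N) [FiniteDimensional K p] [FiniteDimensional K q] :
    FiniteDimensional K (Submodule.map₂ f p q) := by
  rw [TensorProduct.map₂_eq_range_lift_comp_mapIncl]
  infer_instance

theorem finrank_map₂_le {M N P : Type*} [AddCommGroup M] [Module K M] [AddCommGroup N]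
    [Module K N] [AddCommGroup P] [Module K P] (f : M →ₗ[K] N →ₗ[K] P) (p : Submodule K M)
    (q : Submodule K N) [FiniteDimensional K p] [FiniteDimensional K q] :
    Module.finrank K (Submodule.map₂ f p q) ≤ Module.finrank K p * Module.finrank K q := by
  rw [TensorProduct.map₂_eq_range_lift_comp_mapIncl, ← Module.finrank_tensorProduct]
  exact LinearMap.finrank_range_le _

variable {A : Type*} [NonUnitalRing A] [Module K A] [IsScalarTower K A A] [SMulCommClass K A A]
  (V : Submodule K A) [FiniteDimensional K V]

instance finiteDimensional_pow (n : ℕ) : FiniteDimensional K (pow K V n) := by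
  induction n with
  | zero => rw [pow_zero]; infer_instance
  | succ n _ =>
    have := finiteDimensional_map₂ (LinearMap.mul K A) (pow K V n) V
    exact Submodule.finiteDimensional_of_le (pow_succ_le V n)

theorem growth_mono : Monotone (growth K V) := fun _ _ h =>
  Submodule.finrank_mono (pow_mono V h)

theorem growth_lt_pow (n : ℕ) : growth K V n < (Module.finrank K V + 1) ^ n := by
  induction n with
  | zero => simp [growth]
  | succ n ih =>
    have := finiteDimensional_map₂ (LinearMap.mul K A) (pow K V n) V
    have h : growth K V (n + 1) ≤ Module.finrank K V + growth K V n * Module.finrank K V :=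
      calc growth K V (n + 1)
        _ ≤ Module.finrank K ↥(V ⊔ Submodule.map₂ (LinearMap.mul K A) (pow K V n) V) :=
          Submodule.finrank_mono (pow_succ_le V n)
        _ ≤ _ := (Submodule.finrank_add_le_finrank_add_finrank _ _).trans
          (Nat.add_le_add_left (finrank_map₂_le _ _ _) _)
    rw [_root_.pow_succ]
    nlinarith

end Dimension

section FreeSubalgebra

/-- The family `u` freely generates a non-unital subalgebra: the products of `u` along distinct
nonempty words are linearly independent. -/
def FreelyGenerates (K : Type*) [Field K] {A : Type*} [NonUnitalRing A] [Module K A] {α : Type*}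
    (u : α → A) : Prop :=
  LinearIndependent K (FreeSemigroup.lift u)

variable {A B : Type*} [NonUnitalRing A] [Module K A] [NonUnitalRing B] [Module K B]
  {α : Type*} {u : α → A}

theorem freelyGenerates_of_freeMonoid (α : Type*) :
    FreelyGenerates K fun i : α => MonoidAlgebra.of K (FreeMonoid α) (.of i) := by
  have lift_eq (x : FreeSemigroup α) :
      FreeSemigroup.lift (fun i => MonoidAlgebra.of K (FreeMonoid α) (.of i)) x =
        MonoidAlgebra.of K _ x.toFreeMonoid := by
    induction x using FreeSemigroup.recOnMul with
    | ih1 i => simp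
    | ih2 i y hi hy => rw [map_mul, hi, hy, map_mul, map_mul]
  rw [FreelyGenerates, funext lift_eq]
  exact (MonoidAlgebra.basis (FreeMonoid α) K).linearIndependent.comp _
    FreeSemigroup.toFreeMonoid_injective

theorem comp_freeSemigroup_lift (φ : A →ₙₐ[K] B) (u : α → A) :
    φ ∘ FreeSemigroup.lift u = FreeSemigroup.lift (φ ∘ u) :=
  congrArg DFunLike.coe (FreeSemigroup.hom_ext (f := (φ : A →ₙ* B).comp (FreeSemigroup.lift u))
    (g := FreeSemigroup.lift (φ ∘ u)) (by ext; simp))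

theorem FreelyGenerates.of_map (φ : A →ₙₐ[K] B) (h : FreelyGenerates K (φ ∘ u)) :
    FreelyGenerates K u := by
  refine LinearIndependent.of_comp (φ : A →ₗ[K] B) ?_
  change LinearIndependent K (φ ∘ FreeSemigroup.lift u)
  rwa [comp_freeSemigroup_lift]

theorem FreelyGenerates.map {φ : A →ₙₐ[K] B} (hφ : Function.Injective φ)
    (h : FreelyGenerates K u) : FreelyGenerates K (φ ∘ u) := by
  rw [FreelyGenerates, ← comp_freeSemigroup_lift]
  exact LinearIndependent.map_injOn h (φ : A →ₗ[K] B) hφ.injOn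

variable [IsScalarTower K A A] [SMulCommClass K A A]

theorem FreelyGenerates.exists_card_pow_le_growth [Fintype α] (hu : FreelyGenerates K u)
    {V : Submodule K A} (hV : IsGenerating K V) :
    ∃ m, 0 < m ∧ ∀ n, 0 < n → Fintype.card α ^ n ≤ growth K V (m * n) := by
  have := hV.1
  obtain ⟨m, hm, hmem⟩ := hV.exists_pos_forall_mem_pow u
  refine ⟨m, hm, fun n hn => ?_⟩
  obtain ⟨n, rfl⟩ := Nat.exists_eq_succ_of_ne_zero hn.ne'
  let word (p : α × (Fin n → α)) : FreeSemigroup α := ⟨p.1, List.ofFn p.2⟩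
  have word_injective : Function.Injective word := fun p q h =>
    Prod.ext (congrArg FreeSemigroup.head h)
      (List.ofFn_injective (congrArg FreeSemigroup.tail h))
  have length_word (p) : (word p).length = n + 1 := by simp [word, FreeSemigroup.length]
  have lift_word_mem (p) : FreeSemigroup.lift u (word p) ∈ pow K V (m * (n + 1)) :=
    length_word p ▸ lift_mem_pow hmem (word p)
  have hli : LinearIndependent K fun p =>
      (⟨FreeSemigroup.lift u (word p), lift_word_mem p⟩ : pow K V (m * (n + 1))) :=
    LinearIndependent.of_comp (Submodule.subtype _) (hu.comp word word_injective)
  simpa [growth, pow_succ'] using hli.fintype_card_le_finrank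

theorem FreelyGenerates.hasExponentialGrowth [Finite α] [Nontrivial α]
    (hu : FreelyGenerates K u) (hA : ∃ V : Submodule K A, IsGenerating K V) :
    HasExponentialGrowth K A := by
  cases nonempty_fintype α
  have hα : 1 < Fintype.card α := Fintype.one_lt_card
  refine ⟨hA, fun V hV => ⟨Fintype.card α, by exact_mod_cast hα, ?_, ?_⟩⟩
  · have := hV.1
    refine ⟨Module.finrank K V + 1, Nat.succ_pos _, fun n _ => ?_⟩
    beta_reduce
    norm_cast
    calc growth K V n
      _ ≤ (Module.finrank K V + 1) ^ n := (growth_lt_pow V n).le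
      _ ≤ (Fintype.card α ^ (Module.finrank K V + 1)) ^ n :=
        Nat.pow_le_pow_left (Nat.lt_pow_self hα).le n
      _ = Fintype.card α ^ ((Module.finrank K V + 1) * n) := (pow_mul ..).symm
      _ ≤ _ := Nat.le_mul_of_pos_left _ (Nat.succ_pos _)
  · obtain ⟨m, hm, h⟩ := hu.exists_card_pow_le_growth hV
    refine ⟨m, hm, fun n hn => ?_⟩
    beta_reduce
    norm_cast
    exact (h n hn).trans (Nat.le_mul_of_pos_left _ hm)

end FreeSubalgebra

section GKDimension

theorem Preccurly.eventually_pow_le {a : ℝ} (ha : 1 < a) {f : ℕ → ℝ} (hf : Monotone f)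
    (h : Preccurly (fun n => a ^ n) f) (k : ℕ) : ∀ᶠ n : ℕ in atTop, (n : ℝ) ^ k ≤ f n := by
  obtain ⟨c, hc, h⟩ := h
  have hpow : ∀ᶠ q : ℕ in atTop, (c * (2 * c) ^ k) * (q : ℝ) ^ k ≤ a ^ q := by
    have := (isLittleO_pow_const_const_pow_of_one_lt (R := ℝ) k ha).def
      (c := (c * (2 * c) ^ k : ℝ)⁻¹) (by positivity)
    filter_upwards [this] with q hq
    rw [Real.norm_of_nonneg (by positivity), Real.norm_of_nonneg (by positivity)] at hq
    exact (le_inv_mul_iff₀ (by positivity)).1 hq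
  filter_upwards [(Nat.tendsto_div_const_atTop hc.ne').eventually hpow, eventually_ge_atTop c]
    with n hq hn
  have hq_pos : 0 < n / c := Nat.div_pos hn hc
  have hn_le : n ≤ 2 * c * (n / c) := by
    have := Nat.div_add_mod n c
    have := Nat.mod_lt n hc
    nlinarith
  refine le_of_mul_le_mul_left ?_ (Nat.cast_pos.2 hc : (0 : ℝ) < c)
  calc (c : ℝ) * n ^ k
    _ ≤ c * (2 * c * (n / c : ℕ)) ^ k := by gcongr; exact_mod_cast hn_le
    _ = c * (2 * c) ^ k * (n / c : ℕ) ^ k := by ring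
    _ ≤ a ^ (n / c) := hq
    _ ≤ c * f (c * (n / c)) := h _ hq_pos
    _ ≤ c * f n := by gcongr; exact hf (Nat.mul_div_le n c)

theorem tendsto_logb_atTop {f : ℕ → ℝ} (h : ∀ k : ℕ, ∀ᶠ n : ℕ in atTop, (n : ℝ) ^ k ≤ f n) :
    Tendsto (fun n : ℕ => Real.logb n (f n)) atTop atTop := by
  refine tendsto_atTop.2 fun b => ?_
  filter_upwards [h ⌈b⌉₊, eventually_gt_atTop 1] with n hn hn_one
  have hn_one : (1 : ℝ) < n := by exact_mod_cast hn_one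
  have hn_pos : (0 : ℝ) < n ^ ⌈b⌉₊ := by positivity
  rw [Real.le_logb_iff_rpow_le hn_one (hn_pos.trans_le hn)]
  calc (n : ℝ) ^ b
    _ ≤ (n : ℝ) ^ (⌈b⌉₊ : ℝ) := Real.rpow_le_rpow_of_exponent_le hn_one.le (Nat.le_ceil b)
    _ = (n : ℝ) ^ ⌈b⌉₊ := Real.rpow_natCast _ _
    _ ≤ f n := hn

theorem HasExponentialGrowth.hasGKDim_top {A : Type*} [NonUnitalRing A] [Module K A]
    [IsScalarTower K A A] [SMulCommClass K A A] (h : HasExponentialGrowth K A) :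
    HasGKDim K A ⊤ := by
  refine ⟨h.1, fun V hV => Tendsto.limsup_eq (EReal.tendsto_coe_nhds_top_iff.2 ?_)⟩
  have := hV.1
  obtain ⟨a, ha, _, hle⟩ := h.2 V hV
  exact tendsto_logb_atTop (hle.eventually_pow_le ha (Nat.mono_cast.comp (growth_mono V)))

end GKDimension

end AlgGrowth

/-- `a` and `b` satisfy the defining relations of the Leavitt algebra `L(1, n)`: the row with
entries `a i` and the column with entries `b i` are mutually inverse. -/
structure IsLeavittFamily {ι Q : Type*} [Fintype ι] [DecidableEq ι] [Semiring Q]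
    (a b : ι → Q) : Prop where
  mul_eq_ite : ∀ i j, b i * a j = if i = j then 1 else 0
  sum_mul_eq_one : ∑ i, a i * b i = 1

section Operators

variable {ι : Type*} [Fintype ι]

theorem exists_isLeavittFamily_of_linearEquiv [DecidableEq ι] {R M : Type*} [Semiring R]
    [AddCommMonoid M] [Module R M] (e : M ≃ₗ[R] (ι → M)) :
    ∃ a b : ι → Module.End R M, IsLeavittFamily a b := by
  refine ⟨fun i => e.symm.toLinearMap ∘ₗ LinearMap.single R (fun _ => M) i,
    fun i => LinearMap.proj i ∘ₗ e.toLinearMap, fun i j => ?_, ?_⟩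
  · ext x
    rcases eq_or_ne i j with rfl | hij
    · simp
    · simp [hij]
  · ext x
    apply e.injective
    simp [LinearMap.sum_apply, ← map_sum, LinearMap.sum_single_apply]

theorem nonempty_linearEquiv_pi (ι : Type*) [Finite ι] [Nonempty ι] {R M : Type*} [Ring R]
    [StrongRankCondition R] [AddCommGroup M] [Module R M] [Module.Free R M]
    (hM : Cardinal.aleph0 ≤ Module.rank R M) : Nonempty (M ≃ₗ[R] (ι → M)) := by
  cases nonempty_fintype ι
  refine nonempty_linearEquiv_of_lift_rank_eq ?_
  rw [rank_fun_eq_lift_mul, Cardinal.lift_mul, Cardinal.lift_natCast, Cardinal.lift_lift]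
  have hlift := Cardinal.aleph0_le_lift.2 hM
  exact (Cardinal.mul_eq_right hlift ((Cardinal.natCast_lt_aleph0).le.trans hlift)
    (by simp [Fintype.card_ne_zero])).symm

theorem exists_isLeavittFamily [DecidableEq ι] [Nonempty ι] {R M : Type*} [Ring R]
    [StrongRankCondition R] [AddCommGroup M] [Module R M] [Module.Free R M]
    (hM : Cardinal.aleph0 ≤ Module.rank R M) :
    ∃ a b : ι → Module.End R M, IsLeavittFamily a b :=
  let ⟨e⟩ := nonempty_linearEquiv_pi ι hM
  exists_isLeavittFamily_of_linearEquiv e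

end Operators

section InverseMatrices

variable {I S Q : Type*} [DecidableEq I] [DecidableEq S] [Semiring Q]

/-- The matrix with row `i₀` equal to `a` and column `e₀` equal to `c`, except for the common entry
`a e₀ * c i₀`, and zeros elsewhere. -/
def splice (i₀ : I) (e₀ : S) (a : S → Q) (c : I → Q) : Matrix I S Q :=
  Matrix.of fun i e => (if i = i₀ then a e else if e = e₀ then 1 else 0) *
    (if e = e₀ then c i else if i = i₀ then 1 else 0)

variable {i₀ i : I} {e₀ e : S} {a b : S → Q} {c d : I → Q}

theorem splice_apply_left : splice i₀ e₀ a c i₀ e = a e * if e = e₀ then c i₀ else 1 := by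
  simp [splice]

theorem splice_apply_right : splice i₀ e₀ a c i e₀ = (if i = i₀ then a e₀ else 1) * c i := by
  simp [splice]

theorem splice_eq_zero (hi : i ≠ i₀) (he : e ≠ e₀) : splice i₀ e₀ a c i e = 0 := by
  simp [splice, hi, he]

theorem splice_mul_splice [Fintype S] (hab : ∑ e, a e * b e = 1)
    (hcd : ∀ i j, c i * d j = if i = j then 1 else 0) :
    splice i₀ e₀ a c * splice e₀ i₀ d b = 1 := by
  ext i j
  rw [Matrix.mul_apply, Matrix.one_apply]
  by_cases hij : i = i₀ ∧ j = i₀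
  · obtain ⟨rfl, rfl⟩ := hij
    rw [if_pos rfl, ← hab]
    refine Finset.sum_congr rfl fun e _ => ?_
    rw [splice_apply_left, splice_apply_right]
    split_ifs with he
    · rw [mul_assoc, ← mul_assoc (c _), hcd, if_pos rfl, one_mul, he]
    · simp
  · rw [Fintype.sum_eq_single e₀ fun e he => ?_]
    · rw [splice_apply_right, splice_apply_left, mul_assoc, ← mul_assoc (c i), hcd]
      split_ifs <;> simp_all
    · rcases eq_or_ne i i₀ with hi | hi
      · rw [splice_eq_zero he fun hj => hij ⟨hi, hj⟩, mul_zero]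
      · rw [splice_eq_zero hi he, zero_mul]

end InverseMatrices

section Twist

variable {I S Q : Type*} [Fintype I] [DecidableEq I] [Ring Q]

/-- The elementary matrix `1 + c E_{ij}` over a noncommutative ring; compare
`Matrix.transvection`. -/
def elementaryMatrix (i j : I) (c : Q) : Matrix I I Q := 1 + Matrix.single i j c

theorem elementaryMatrix_mul_apply_same (i j : I) (c : Q) (X : Matrix I S Q) (e : S) :
    (elementaryMatrix i j c * X : Matrix I S Q) i e = X i e + c * X j e := by
  simp [elementaryMatrix, Matrix.add_mul]

theorem elementaryMatrix_mul_apply_of_ne {i k : I} (hk : k ≠ i) (j : I) (c : Q)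
    (X : Matrix I S Q) (e : S) : (elementaryMatrix i j c * X : Matrix I S Q) k e = X k e := by
  simp [elementaryMatrix, Matrix.add_mul, hk]

theorem mul_elementaryMatrix_apply_same (i j : I) (c : Q) (Y : Matrix S I Q) (e : S) :
    (Y * elementaryMatrix i j c : Matrix S I Q) e j = Y e j + Y e i * c := by
  simp [elementaryMatrix, Matrix.mul_add]

theorem mul_elementaryMatrix_apply_of_ne {j k : I} (hk : k ≠ j) (i : I) (c : Q)
    (Y : Matrix S I Q) (e : S) : (Y * elementaryMatrix i j c : Matrix S I Q) e k = Y e k := by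
  simp [elementaryMatrix, Matrix.mul_add, hk]

theorem elementaryMatrix_mul_elementaryMatrix {i j : I} (hij : i ≠ j) {c d : Q} (h : c + d = 0) :
    elementaryMatrix i j c * elementaryMatrix i j d = 1 := by
  simp [elementaryMatrix, add_mul, mul_add, Matrix.single_mul_single_of_ne, hij.symm, add_assoc,
    ← Matrix.single_add, h]

theorem mul_mul_mul_eq_one {l m n : Type*} [Fintype m] [Fintype n] [DecidableEq m] [DecidableEq l]
    {A : Matrix l m Q} {B : Matrix m n Q} {C : Matrix n m Q} {D : Matrix m l Q} (hBC : B * C = 1)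
    (hAD : A * D = 1) : A * B * (C * D) = 1 := by
  rw [Matrix.mul_assoc, ← Matrix.mul_assoc B, hBC, Matrix.one_mul, hAD]

variable [DecidableEq S]

/-- The matrix `splice i₀ e₀ a c` after adding `ν` times row `i₀` to row `i₁` and then subtracting
`μ` times row `i₁` from row `i₀`. -/
def twistedSplice (i₀ i₁ : I) (e₀ : S) (μ ν : Q) (a : S → Q) (c : I → Q) : Matrix I S Q :=
  elementaryMatrix i₀ i₁ (-μ) * (elementaryMatrix i₁ i₀ ν * splice i₀ e₀ a c)

/-- The matrix `splice e₀ i₀ d b` after the column operations inverse to the row operations in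
`twistedSplice`. -/
def twistedSpliceInv (i₀ i₁ : I) (e₀ : S) (μ ν : Q) (d : I → Q) (b : S → Q) : Matrix S I Q :=
  splice e₀ i₀ d b * elementaryMatrix i₁ i₀ (-ν) * elementaryMatrix i₀ i₁ μ

variable {i₀ i₁ i : I} {e₀ e : S} {μ ν : Q} {a b : S → Q} {c d : I → Q}

theorem twistedSplice_apply (hi₁ : i₁ ≠ i₀) (hi : i ≠ i₀) (he : e ≠ e₀) :
    twistedSplice i₀ i₁ e₀ μ ν a c i e = if i = i₁ then ν * a e else 0 := by
  rw [twistedSplice, elementaryMatrix_mul_apply_of_ne hi]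
  split_ifs with h
  · rw [h, elementaryMatrix_mul_apply_same, splice_eq_zero hi₁ he, splice_apply_left,
      if_neg he, mul_one, zero_add]
  · rw [elementaryMatrix_mul_apply_of_ne h, splice_eq_zero hi he]

theorem splice_mul_elementaryMatrix_apply (hi₁ : i₁ ≠ i₀) (he : e ≠ e₀) :
    (splice e₀ i₀ d b * elementaryMatrix i₁ i₀ ν : Matrix S I Q) e i₀ = b e := by
  rw [mul_elementaryMatrix_apply_same, splice_eq_zero he hi₁, splice_apply_right, if_neg he,
    one_mul, zero_mul, add_zero]

theorem twistedSpliceInv_apply_pivot (hi₁ : i₁ ≠ i₀) (he : e ≠ e₀) :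
    twistedSpliceInv i₀ i₁ e₀ μ ν d b e i₀ = b e := by
  rw [twistedSpliceInv, mul_elementaryMatrix_apply_of_ne hi₁.symm,
    splice_mul_elementaryMatrix_apply hi₁ he]

theorem twistedSpliceInv_apply (hi₁ : i₁ ≠ i₀) (hi : i ≠ i₀) (he : e ≠ e₀) :
    twistedSpliceInv i₀ i₁ e₀ μ ν d b e i = if i = i₁ then b e * μ else 0 := by
  rw [twistedSpliceInv]
  split_ifs with h
  · rw [h, mul_elementaryMatrix_apply_same, splice_mul_elementaryMatrix_apply hi₁ he,
      mul_elementaryMatrix_apply_of_ne hi₁, splice_eq_zero he hi₁, zero_add]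
  · rw [mul_elementaryMatrix_apply_of_ne h, mul_elementaryMatrix_apply_of_ne hi,
      splice_eq_zero he hi]

variable [Fintype S]

theorem twistedSplice_mul_twistedSpliceInv (hi₁ : i₁ ≠ i₀) (hab : IsLeavittFamily a b)
    (hdc : IsLeavittFamily d c) :
    twistedSplice i₀ i₁ e₀ μ ν a c * twistedSpliceInv i₀ i₁ e₀ μ ν d b = 1 := by
  refine mul_mul_mul_eq_one ?_ (elementaryMatrix_mul_elementaryMatrix hi₁.symm (neg_add_cancel μ))
  exact mul_mul_mul_eq_one (splice_mul_splice hab.sum_mul_eq_one hdc.mul_eq_ite)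
    (elementaryMatrix_mul_elementaryMatrix hi₁ (add_neg_cancel ν))

theorem twistedSpliceInv_mul_twistedSplice (hi₁ : i₁ ≠ i₀) (hab : IsLeavittFamily a b)
    (hdc : IsLeavittFamily d c) :
    twistedSpliceInv i₀ i₁ e₀ μ ν d b * twistedSplice i₀ i₁ e₀ μ ν a c = 1 := by
  refine mul_mul_mul_eq_one
    (elementaryMatrix_mul_elementaryMatrix hi₁.symm (add_neg_cancel μ)) ?_
  exact mul_mul_mul_eq_one (elementaryMatrix_mul_elementaryMatrix hi₁ (neg_add_cancel ν))
    (splice_mul_splice hdc.sum_mul_eq_one hab.mul_eq_ite)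

/-- Since `b g * a g = b e₀ * a e₀ = 1` and `b g * a e₀ = b e₀ * a g = 0`, the entries `b g`,
`b g * μ = b e₀` and `ν * a g = a g * s + a e₀ * t` give arbitrary products `s` and `t`. -/
theorem exists_inverse_matrices_mul_apply_eq
    (hab : IsLeavittFamily a b) (hdc : IsLeavittFamily d c) (hi₁ : i₁ ≠ i₀) {g : S}
    (hg : g ≠ e₀) (s t : Q) :
    ∃ (X : Matrix I S Q) (Y : Matrix S I Q), X * Y = 1 ∧ Y * X = 1 ∧
      (∀ i e, i ≠ i₀ → e ≠ e₀ → ¬ (i = i₁ ∧ e = g) → X i e = 0 ∧ Y e i = 0) ∧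
      Y g i₀ * X i₁ g = s ∧ Y g i₁ * X i₁ g = t := by
  have ν_mul_a (e) : (a g * s + a e₀ * t) * b g * a e =
      if g = e then a g * s + a e₀ * t else 0 := by
    rw [mul_assoc, hab.mul_eq_ite, mul_ite, mul_one, mul_zero]
  have b_mul_μ (e) : b e * (a g * b e₀) = if e = g then b e₀ else 0 := by
    rw [← mul_assoc, hab.mul_eq_ite, ite_mul, one_mul, zero_mul]
  refine ⟨twistedSplice i₀ i₁ e₀ (a g * b e₀) ((a g * s + a e₀ * t) * b g) a c,
    twistedSpliceInv i₀ i₁ e₀ (a g * b e₀) ((a g * s + a e₀ * t) * b g) d b,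
    twistedSplice_mul_twistedSpliceInv hi₁ hab hdc,
    twistedSpliceInv_mul_twistedSplice hi₁ hab hdc, fun i e hi he hne => ?_, ?_, ?_⟩
  · rw [twistedSplice_apply hi₁ hi he, twistedSpliceInv_apply hi₁ hi he, ν_mul_a, b_mul_μ]
    constructor <;> split_ifs <;> simp_all
  · rw [twistedSplice_apply hi₁ hi₁ hg, twistedSpliceInv_apply_pivot hi₁ hg, if_pos rfl, ν_mul_a,
      if_pos rfl, mul_add, ← mul_assoc, ← mul_assoc, hab.mul_eq_ite, hab.mul_eq_ite, if_pos rfl,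
      if_neg hg, one_mul, zero_mul, add_zero]
  · rw [twistedSplice_apply hi₁ hi₁ hg, twistedSpliceInv_apply hi₁ hi₁ hg, if_pos rfl, if_pos rfl,
      ν_mul_a, b_mul_μ, if_pos rfl, if_pos rfl, mul_add, ← mul_assoc, ← mul_assoc, hab.mul_eq_ite,
      hab.mul_eq_ite, if_pos rfl, if_neg hg.symm, one_mul, zero_mul, zero_add]

end Twist

section FreePair

variable (K : Type*) [Field K]

theorem aleph0_le_rank_monoidAlgebra_freeMonoid (α : Type*) [Nonempty α] :
    Cardinal.aleph0 ≤ Module.rank K (MonoidAlgebra K (FreeMonoid α)) := by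
  rw [← Cardinal.aleph0_le_lift, ← (MonoidAlgebra.basis (FreeMonoid α) K).mk_eq_rank]
  exact Cardinal.aleph0_le_lift.2 (Cardinal.aleph0_le_mk (List α))

theorem exists_freelyGenerates_end (α : Type*) :
    ∃ u : α → Module.End K (MonoidAlgebra K (FreeMonoid α)), AlgGrowth.FreelyGenerates K u :=
  ⟨_, (AlgGrowth.freelyGenerates_of_freeMonoid α).map
    (φ := (Algebra.lmul K (MonoidAlgebra K (FreeMonoid α)) : _ →ₙₐ[K] _))
    Algebra.lmul_injective⟩

end FreePair

namespace NonUnitalPresentation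

variable {K : Type*} [Field K] {X : Type*} {r : Free K X → Free K X → Prop}

section Lift

variable {B : Type*} [NonUnitalRing B] [Module K B]

theorem apply_eq_of_con (F : Free K X →ₙₐ[K] B) (hF : ∀ a b, r a b → F a = F b)
    {a b : Free K X} (h : con r a b) : F a = F b := by
  suffices con r ≤ RingCon.comap ⊥ F from this h
  refine RingCon.ringConGen_le.2 ?_
  rintro _ _ ⟨c, x, y, hxy, rfl, rfl⟩
  change F (c • x) = F (c • y)
  rw [map_smul, map_smul, hF x y hxy]

/-- The homomorphism of non-unital algebras out of `Alg r` induced by a homomorphism out of the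
free algebra that respects the relations. -/
noncomputable def lift (F : Free K X →ₙₐ[K] B) (hF : ∀ a b, r a b → F a = F b) :
    Alg r →ₙₐ[K] B where
  toFun := Quotient.lift F fun _ _ => apply_eq_of_con F hF
  map_smul' c := (mkAdd_surjective r).forall.2 fun a => map_smul F c a
  map_zero' := map_zero F
  map_add' := (mkAdd_surjective r).forall₂.2 fun a b => map_add F a b
  map_mul' := (mkAdd_surjective r).forall₂.2 fun a b => map_mul F a b

theorem lift_mk (F : Free K X →ₙₐ[K] B) (hF : ∀ a b, r a b → F a = F b) (a : Free K X) :
    lift F hF (mk r a) = F a := rfl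

end Lift

theorem adjoin_range_gen :
    NonUnitalAlgebra.adjoin K (Set.range (gen K : X → Free K X)) = ⊤ := by
  refine top_le_iff.1 fun a _ => ?_
  induction a using MonoidAlgebra.induction_linear with
  | zero => exact zero_mem _
  | add a b ha hb => exact add_mem (ha trivial) (hb trivial)
  | single x c =>
    suffices MonoidAlgebra.single x (1 : K) ∈
        NonUnitalAlgebra.adjoin K (Set.range (gen K : X → Free K X)) by
      simpa [MonoidAlgebra.smul_single] using SMulMemClass.smul_mem c this
    induction x using FreeSemigroup.recOnMul with
    | ih1 x => exact NonUnitalAlgebra.subset_adjoin K ⟨x, rfl⟩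
    | ih2 x y hx hy =>
      simpa [MonoidAlgebra.single_mul_single] using mul_mem (hx trivial) (hy trivial)

variable (r) in
theorem adjoin_range_mk_gen :
    NonUnitalAlgebra.adjoin K (Set.range fun x => mk r (gen K x)) = ⊤ := by
  change NonUnitalAlgebra.adjoin K (Set.range (mk r ∘ gen K)) = ⊤
  rw [Set.range_comp, ← NonUnitalAlgHom.map_adjoin, adjoin_range_gen, NonUnitalAlgebra.map_top,
    NonUnitalAlgebra.range_eq_top]
  exact mkAdd_surjective r

variable (r) in
theorem exists_isGenerating [Finite X] :
    ∃ V : Submodule K (Alg r), AlgGrowth.IsGenerating K V :=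
  ⟨_, AlgGrowth.isGenerating_span_of_adjoin_eq_top (Set.finite_range _) (adjoin_range_mk_gen r)⟩

end NonUnitalPresentation

namespace WeightedGraph

open NonUnitalPresentation

/-- `X` and `Y` represent the relations of a weighted Leavitt path algebra at a vertex: the set of
edges emitted by the vertex is `S`, the weight of the vertex is `W`, and all vertices act as the
identity. -/
structure IsVertexRep {S Q : Type*} [Fintype S] [DecidableEq S] [Semiring Q] (w : S → ℕ) {W : ℕ}
    (X : Matrix (Fin W) S Q) (Y : Matrix S (Fin W) Q) : Prop where
  real_mul_ghost : X * Y = 1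
  ghost_mul_real : Y * X = 1
  real_eq_zero : ∀ (e : S) (i : Fin W), w e ≤ i → X i e = 0
  ghost_eq_zero : ∀ (e : S) (i : Fin W), w e ≤ i → Y e i = 0

section VertexRep

variable {R M : Type*} [Ring R] [StrongRankCondition R] [AddCommGroup M] [Module R M]
  [Module.Free R M] (hM : Cardinal.aleph0 ≤ Module.rank R M)
  {S : Type*} [Fintype S] [DecidableEq S] {w : S → ℕ} (hw : ∀ e, 0 < w e)
  {W : ℕ} (hW : Finset.univ.sup w = W)

include hM hw hW

theorem exists_isVertexRep :
    ∃ (X : Matrix (Fin W) S (Module.End R M)) (Y : Matrix S (Fin W) (Module.End R M)),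
      IsVertexRep w X Y := by
  cases isEmpty_or_nonempty S
  · obtain rfl : W = 0 := by simpa using hW.symm
    exact ⟨0, 0, Subsingleton.elim _ _, Subsingleton.elim _ _, by simp, by simp⟩
  obtain ⟨e₀, -, he₀⟩ := Finset.exists_mem_eq_sup _ Finset.univ_nonempty w
  have : NeZero W := ⟨(hW ▸ he₀ ▸ hw e₀).ne'⟩
  have ne_of_le {e : S} {i : Fin W} (hi : w e ≤ i) : i ≠ 0 ∧ e ≠ e₀ := by
    constructor
    · rintro rfl
      exact (hw e).not_ge hi
    · rintro rfl
      omega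
  obtain ⟨a, b, hab⟩ := exists_isLeavittFamily (ι := S) hM
  obtain ⟨d, c, hdc⟩ := exists_isLeavittFamily (ι := Fin W) hM
  exact ⟨splice 0 e₀ a c, splice e₀ 0 d b,
    splice_mul_splice hab.sum_mul_eq_one hdc.mul_eq_ite,
    splice_mul_splice hdc.sum_mul_eq_one hab.mul_eq_ite,
    fun _ _ hi => splice_eq_zero (ne_of_le hi).1 (ne_of_le hi).2,
    fun _ _ hi => splice_eq_zero (ne_of_le hi).2 (ne_of_le hi).1⟩

theorem exists_isVertexRep_mul_apply_eq {e f : S} (hef : e ≠ f) (he : 2 ≤ w e) (hf : 2 ≤ w f)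
    (u : Bool → Module.End R M) :
    ∃ (X : Matrix (Fin W) S (Module.End R M)) (Y : Matrix S (Fin W) (Module.End R M)),
      IsVertexRep w X Y ∧
        ∃ (g : S) (i : Bool → Fin W) (j : Fin W), ∀ b, Y g (i b) * X j g = u b := by
  have : Nonempty S := ⟨e⟩
  obtain ⟨e₀, -, he₀⟩ := Finset.exists_mem_eq_sup _ Finset.univ_nonempty w
  obtain ⟨g, hg, hg₀⟩ : ∃ g, 2 ≤ w g ∧ g ≠ e₀ := by
    rcases eq_or_ne e e₀ with rfl | he'
    exacts [⟨f, hf, hef.symm⟩, ⟨e, he, he'⟩]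
  have two_le : 2 ≤ W := hW ▸ he.trans (Finset.le_sup (Finset.mem_univ e))
  have : NeZero W := ⟨by omega⟩
  obtain ⟨a, b, hab⟩ := exists_isLeavittFamily (ι := S) hM
  obtain ⟨d, c, hdc⟩ := exists_isLeavittFamily (ι := Fin W) hM
  obtain ⟨X, Y, hXY, hYX, hzero, hfalse, htrue⟩ := exists_inverse_matrices_mul_apply_eq hab hdc
    (i₀ := 0) (i₁ := ⟨1, two_le⟩) (by simp [Fin.ext_iff]) hg₀ (u false) (u true)
  have eq_zero {e : S} {i : Fin W} (hi : w e ≤ i) : X i e = 0 ∧ Y e i = 0 := by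
    refine hzero i e ?_ ?_ ?_
    · rintro rfl
      exact (hw e).not_ge hi
    · rintro rfl
      omega
    · rintro ⟨rfl, rfl⟩
      exact hg.not_gt (Nat.lt_succ_of_le hi)
  exact ⟨X, Y, ⟨hXY, hYX, fun _ _ hi => (eq_zero hi).1, fun _ _ hi => (eq_zero hi).2⟩,
    g, fun b => cond b ⟨1, two_le⟩ 0, ⟨1, two_le⟩, Bool.rec hfalse htrue⟩

end VertexRep

section Gluing

variable {V E : Type*} {G : WeightedGraph V E}

theorem mem_out {v : V} {e : E} : e ∈ G.out v ↔ G.s e = v := by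
  simp [out]

theorem univ_sup_w (v : V) :
    (Finset.univ.sup fun e : G.out v => G.w e) = G.vertexWeight v := by
  rw [vertexWeight, ← Finset.sup_attach (G.out v) G.w, Finset.univ_eq_attach]

theorem w_le_vertexWeight (e : E) : G.w e ≤ G.vertexWeight (G.s e) :=
  Finset.le_sup (mem_out.2 rfl)

instance [Finite V] [Finite E] : Finite G.Letter := by
  let φ : V ⊕ (Σ e, Fin (G.w e)) ⊕ (Σ e, Fin (G.w e)) → G.Letter :=
    Sum.elim .vertex (Sum.elim (fun x => .real x.1 x.2) fun x => .ghost x.1 x.2)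
  refine Finite.of_surjective φ fun
    | .vertex v => ⟨.inl v, rfl⟩
    | .real e i => ⟨.inr (.inl ⟨e, i⟩), rfl⟩
    | .ghost e i => ⟨.inr (.inr ⟨e, i⟩), rfl⟩

variable (K : Type*) [Field K] {Q : Type*} [Ring Q] [Algebra K Q] [Fintype V] [DecidableEq V]
  (X : ∀ v, Matrix (Fin (G.vertexWeight v)) (G.out v) Q)
  (Y : ∀ v, Matrix (G.out v) (Fin (G.vertexWeight v)) Q)

/-- The homomorphism from the free algebra that sends a vertex `v` to the matrix unit `E_{vv}`, and
a real or ghost edge to the multiple of the matrix unit from its source to its range prescribed by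
`X` or `Y`. -/
noncomputable def freeRep : Free K G.Letter →ₙₐ[K] Matrix V V Q :=
  MonoidAlgebra.liftMagma K <| FreeSemigroup.lift fun
    | .vertex v => .single v v 1
    | .real e i => .single (G.s e) (G.r e)
        (X (G.s e) (i.castLE (w_le_vertexWeight e)) ⟨e, mem_out.2 rfl⟩)
    | .ghost e i => .single (G.r e) (G.s e)
        (Y (G.s e) ⟨e, mem_out.2 rfl⟩ (i.castLE (w_le_vertexWeight e)))

theorem freeRep_vtx (v : V) : freeRep K X Y (G.vtx K v) = .single v v 1 := by
  simp [freeRep, vtx, gen]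

theorem vtx_mul_freeRep_gen (x : G.Letter) :
    .single x.source x.source 1 * freeRep K X Y (gen K x) = freeRep K X Y (gen K x) := by
  cases x <;> simp [freeRep, gen, Letter.source]

theorem freeRep_gen_mul_vtx (x : G.Letter) :
    freeRep K X Y (gen K x) * .single x.range x.range 1 = freeRep K X Y (gen K x) := by
  cases x <;> simp [freeRep, gen, Letter.range]

variable {X Y} {v : V} [∀ v, DecidableEq (G.out v)]
  (hXY : ∀ v, IsVertexRep (fun e : G.out v => G.w e) (X v) (Y v))

include hXY

theorem freeRep_re (e : G.out v) (i : Fin (G.vertexWeight v)) :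
    freeRep K X Y (G.re K e i) = .single v (G.r e) (X v i e) := by
  obtain ⟨e, he⟩ := e
  obtain rfl := mem_out.1 he
  rw [re]
  split_ifs with hi
  · simp [freeRep, gen]
  · rw [(hXY _).real_eq_zero _ i (not_lt.1 hi), Matrix.single_zero, map_zero]

theorem freeRep_gh (e : G.out v) (i : Fin (G.vertexWeight v)) :
    freeRep K X Y (G.gh K e i) = .single (G.r e) v (Y v e i) := by
  obtain ⟨e, he⟩ := e
  obtain rfl := mem_out.1 he
  rw [gh]
  split_ifs with hi
  · simp [freeRep, gen]
  · rw [(hXY _).ghost_eq_zero _ i (not_lt.1 hi), Matrix.single_zero, map_zero]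

theorem freeRep_sum_re_mul_gh (i j : Fin (G.vertexWeight v)) :
    freeRep K X Y (∑ e ∈ G.out v, G.re K e i * G.gh K e j) =
      .single v v (if i = j then 1 else 0) := by
  rw [← Matrix.one_apply, ← (hXY v).real_mul_ghost, Matrix.mul_apply, ← Finset.sum_coe_sort,
    map_sum, ← Matrix.singleAddMonoidHom_apply, map_sum]
  simp only [map_mul, freeRep_re K hXY, freeRep_gh K hXY, Matrix.single_mul_single_same,
    Matrix.singleAddMonoidHom_apply]

theorem freeRep_sum_gh_mul_re (e f : G.out v) :
    freeRep K X Y (∑ i ∈ Finset.range (G.vertexWeight v), G.gh K e i * G.re K f i) =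
      .single (G.r e) (G.r f) (if e = f then 1 else 0) := by
  rw [← Matrix.one_apply, ← (hXY v).ghost_mul_real, Matrix.mul_apply,
    ← Fin.sum_univ_eq_sum_range fun i => G.gh K e i * G.re K f i,
    map_sum, ← Matrix.singleAddMonoidHom_apply, map_sum]
  simp only [map_mul, freeRep_re K hXY, freeRep_gh K hXY, Matrix.single_mul_single_same,
    Matrix.singleAddMonoidHom_apply]

theorem freeRep_eq_of_rel {a b : Free K G.Letter} (h : G.Rel K a b) :
    freeRep K X Y a = freeRep K X Y b := by
  cases h with
  | vertex_mul u v =>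
    rw [map_mul, freeRep_vtx, freeRep_vtx]
    split_ifs with huv
    · rw [huv, freeRep_vtx, Matrix.single_mul_single_same, mul_one]
    · rw [map_zero, Matrix.single_mul_single_of_ne _ _ _ _ huv]
  | source_mul x => rw [map_mul, freeRep_vtx, vtx_mul_freeRep_gen]
  | mul_range x => rw [map_mul, freeRep_vtx, freeRep_gen_mul_vtx]
  | real_ghost v _ i j hi hj =>
    refine (freeRep_sum_re_mul_gh K hXY ⟨i, hi⟩ ⟨j, hj⟩).trans ?_
    split_ifs with hij hij' hij' <;> simp_all [freeRep_vtx]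
  | ghost_real v e f he hf =>
    refine (freeRep_sum_gh_mul_re K hXY ⟨e, he⟩ ⟨f, hf⟩).trans ?_
    split_ifs with hef hef' hef' <;> simp_all [freeRep_vtx]

/-- The representation of the weighted Leavitt path algebra by matrices indexed by the vertices
that is glued from representations of the relations at the single vertices. -/
noncomputable def leavittPathRep : G.LeavittPathAlgebra K →ₙₐ[K] Matrix V V Q :=
  NonUnitalPresentation.lift (freeRep K X Y) fun _ _ => freeRep_eq_of_rel K hXY

@[simp]
theorem leavittPathRep_mk (a : Free K G.Letter) :
    leavittPathRep K hXY (NonUnitalPresentation.mk _ a) = freeRep K X Y a :=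
  NonUnitalPresentation.lift_mk ..

end Gluing

section Growth

/-- The corner embedding of `Q` at position `(p, p)` into the matrices over `Q`. -/
def cornerHom (K : Type*) {V Q : Type*} [Field K] [Ring Q] [Algebra K Q] [Fintype V] [DecidableEq V]
    (p : V) : Q →ₙₐ[K] Matrix V V Q where
  toFun := Matrix.single p p
  map_smul' c x := (Matrix.smul_single c p p x).symm
  map_zero' := Matrix.single_zero p p
  map_add' := Matrix.single_add p p
  map_mul' _ _ := (Matrix.single_mul_single_same ..).symm

theorem cornerHom_injective (K : Type*) {V Q : Type*} [Field K] [Ring Q] [Algebra K Q] [Fintype V]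
    [DecidableEq V] (p : V) : Function.Injective (cornerHom K p : Q →ₙₐ[K] Matrix V V Q) :=
  fun x y h => by simpa [cornerHom] using congrFun₂ h p p

variable (K : Type*) [Field K] {V E : Type*} [Finite V] {G : WeightedGraph V E} {e f : E}

theorem exists_freelyGenerates (hef : e ≠ f) (hs : G.s e = G.s f) (he : 2 ≤ G.w e)
    (hf : 2 ≤ G.w f) :
    ∃ u : Bool → G.LeavittPathAlgebra K, AlgGrowth.FreelyGenerates K u := by
  classical
  cases nonempty_fintype V
  have hM := aleph0_le_rank_monoidAlgebra_freeMonoid K Bool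
  obtain ⟨u, hu⟩ := exists_freelyGenerates_end K Bool
  have w_pos (v) (e : G.out v) : 0 < G.w e := G.w_pos e
  obtain ⟨X₀, Y₀, h₀, g, i, j, hij⟩ := exists_isVertexRep_mul_apply_eq hM (w_pos (G.s e))
    (univ_sup_w _) (e := ⟨e, mem_out.2 rfl⟩) (f := ⟨f, mem_out.2 hs.symm⟩)
    (by simpa using hef) he hf u
  choose X Y hXY using fun v => exists_isVertexRep hM (w_pos v) (univ_sup_w v)
  let X' := Function.update X (G.s e) X₀
  let Y' := Function.update Y (G.s e) Y₀
  have hXY' (v) : IsVertexRep (fun e : G.out v => G.w e) (X' v) (Y' v) := by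
    rcases eq_or_ne v (G.s e) with rfl | hv
    · simpa only [X', Y', Function.update_self] using h₀
    · simpa only [X', Y', Function.update_of_ne hv] using hXY v
  refine ⟨fun b => NonUnitalPresentation.mk _ (G.gh K g (i b) * G.re K g j),
    .of_map (leavittPathRep K hXY') ?_⟩
  convert hu.map (cornerHom_injective K (G.r g)) using 1
  funext b
  simp [freeRep_re K hXY', freeRep_gh K hXY', X', Y', hij, cornerHom]

theorem hasExponentialGrowth_leavittPathAlgebra [Finite E] (hef : e ≠ f) (hs : G.s e = G.s f)
    (he : 2 ≤ G.w e) (hf : 2 ≤ G.w f) :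
    AlgGrowth.HasExponentialGrowth K (G.LeavittPathAlgebra K) :=
  let ⟨_, hu⟩ := exists_freelyGenerates K hef hs he hf
  hu.hasExponentialGrowth (exists_isGenerating _)

end Growth

end WeightedGraph

namespace LeavittAlgebra

variable (K : Type*) [Field K] {m n : ℕ}

theorem exists_isGenerating :
    ∃ V : Submodule K (LeavittAlgebra K m n), AlgGrowth.IsGenerating K V := by
  let ι (l : Letter m n) : LeavittAlgebra K m n := RingQuot.mkAlgHom K _ (FreeAlgebra.ι K l)
  refine ⟨_, AlgGrowth.isGenerating_span_of_adjoin_eq_top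
    ((Set.finite_range ι).insert 1) (top_le_iff.1 fun y _ => ?_)⟩
  obtain ⟨a, rfl⟩ := RingQuot.mkAlgHom_surjective K (Rel K m n) y
  induction a using FreeAlgebra.induction with
  | grade0 c =>
    rw [AlgHom.commutes, Algebra.algebraMap_eq_smul_one]
    exact SMulMemClass.smul_mem c (NonUnitalAlgebra.subset_adjoin K (Set.mem_insert _ _))
  | grade1 l => exact NonUnitalAlgebra.subset_adjoin K (Set.mem_insert_of_mem _ ⟨l, rfl⟩)
  | mul a b ha hb => rw [map_mul]; exact mul_mem (ha trivial) (hb trivial)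
  | add a b ha hb => rw [map_add]; exact add_mem (ha trivial) (hb trivial)

section Lift

variable {Q : Type*} [Ring Q] [Algebra K Q] (A : Matrix (Fin m) (Fin n) Q)
  (B : Matrix (Fin n) (Fin m) Q)

/-- The homomorphism from the free algebra that specializes the generic matrices to `A` and `B`. -/
noncomputable def freeLift : FreeAlgebra K (Letter m n) →ₐ[K] Q :=
  FreeAlgebra.lift K (Sum.elim (fun p => A p.1 p.2) fun p => B p.1 p.2)

theorem map_freeLift_X : (X K m n).map (freeLift K A B) = A := by
  ext; simp [freeLift, X]

theorem map_freeLift_Y : (Y K m n).map (freeLift K A B) = B := by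
  ext; simp [freeLift, Y]

variable {A B} (hAB : A * B = 1) (hBA : B * A = 1)

include hAB hBA in
theorem freeLift_eq_of_rel {a b : FreeAlgebra K (Letter m n)} (h : Rel K m n a b) :
    freeLift K A B a = freeLift K A B b := by
  cases h with
  | mul_left i j =>
    have h : (X K m n * Y K m n).map (freeLift K A B) =
        (1 : Matrix _ _ _).map (freeLift K A B) := by
      rw [Matrix.map_mul, map_freeLift_X, map_freeLift_Y, hAB,
        Matrix.map_one _ (map_zero _) (map_one _)]
    exact congrFun₂ h i j
  | mul_right i j =>
    have h : (Y K m n * X K m n).map (freeLift K A B) =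
        (1 : Matrix _ _ _).map (freeLift K A B) := by
      rw [Matrix.map_mul, map_freeLift_X, map_freeLift_Y, hBA,
        Matrix.map_one _ (map_zero _) (map_one _)]
    exact congrFun₂ h i j

/-- The homomorphism from the Leavitt algebra given by a pair of mutually inverse matrices. -/
noncomputable def lift : LeavittAlgebra K m n →ₐ[K] Q :=
  RingQuot.liftAlgHom K ⟨freeLift K A B, fun _ _ => freeLift_eq_of_rel K hAB hBA⟩

theorem lift_X (i : Fin m) (j : Fin n) :
    lift K hAB hBA (RingQuot.mkAlgHom K _ (X K m n i j)) = A i j :=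
  (RingQuot.liftAlgHom_mkAlgHom_apply _ _ _ _).trans (congrFun₂ (map_freeLift_X K A B) i j)

theorem lift_Y (j : Fin n) (i : Fin m) :
    lift K hAB hBA (RingQuot.mkAlgHom K _ (Y K m n j i)) = B j i :=
  (RingQuot.liftAlgHom_mkAlgHom_apply _ _ _ _).trans (congrFun₂ (map_freeLift_Y K A B) j i)

end Lift

theorem exists_freelyGenerates (hm : 1 < m) (hn : 1 < n) :
    ∃ u : Bool → LeavittAlgebra K m n, AlgGrowth.FreelyGenerates K u := by
  have : NeZero m := ⟨by omega⟩
  have : NeZero n := ⟨by omega⟩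
  have hM := aleph0_le_rank_monoidAlgebra_freeMonoid K Bool
  obtain ⟨u, hu⟩ := exists_freelyGenerates_end K Bool
  obtain ⟨a, b, hab⟩ := exists_isLeavittFamily (ι := Fin n) hM
  obtain ⟨d, c, hdc⟩ := exists_isLeavittFamily (ι := Fin m) hM
  obtain ⟨A, B, hAB, hBA, -, hfalse, htrue⟩ := exists_inverse_matrices_mul_apply_eq hab hdc
    (i₀ := 0) (i₁ := ⟨1, hm⟩) (e₀ := 0) (g := ⟨1, hn⟩) (by simp [Fin.ext_iff])
    (by simp [Fin.ext_iff]) (u false) (u true)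
  refine ⟨fun b => RingQuot.mkAlgHom K _
    (Y K m n ⟨1, hn⟩ (cond b ⟨1, hm⟩ 0) * X K m n ⟨1, hm⟩ ⟨1, hn⟩),
    .of_map (lift K hAB hBA).toNonUnitalAlgHom ?_⟩
  convert hu using 1
  funext b
  change lift K hAB hBA (RingQuot.mkAlgHom K _ (Y K m n _ _ * X K m n _ _)) = u b
  rw [map_mul, map_mul, lift_X, lift_Y]
  cases b
  exacts [hfalse, htrue]

theorem hasExponentialGrowth (hm : 1 < m) (hn : 1 < n) :
    AlgGrowth.HasExponentialGrowth K (LeavittAlgebra K m n) :=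
  let ⟨_, hu⟩ := exists_freelyGenerates K hm hn
  hu.hasExponentialGrowth (exists_isGenerating K)

end LeavittAlgebra

theorem mainTheorem5 (K : Type*) [Field K] :
    (∀ (V : Type*) (E : Type*) [Finite V] [Finite E] (G : WeightedGraph V E)
        (v : V) (e f : E), e ≠ f → G.s e = v → G.s f = v → 2 ≤ G.w e → 2 ≤ G.w f →
        AlgGrowth.HasExponentialGrowth K (G.LeavittPathAlgebra K) ∧
        AlgGrowth.HasGKDim K (G.LeavittPathAlgebra K) ⊤) ∧
    (∀ n k : ℕ, 1 < n →
        AlgGrowth.HasExponentialGrowth K (LeavittAlgebra K n (n + k)) ∧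
        AlgGrowth.HasGKDim K (LeavittAlgebra K n (n + k)) ⊤) := by
  refine ⟨fun V E _ _ G v e f hef he hf hwe hwf => ?_, fun n k hn => ?_⟩
  · have h := WeightedGraph.hasExponentialGrowth_leavittPathAlgebra K hef (he.trans hf.symm) hwe hwf
    exact ⟨h, h.hasGKDim_top⟩
  · have h := LeavittAlgebra.hasExponentialGrowth K hn (hn.trans_le (Nat.le_add_right n k))
    exact ⟨h, h.hasGKDim_top⟩
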